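/- Let $k$ be an algebraically closed field of characteristic zero. A variety over $k$ means an algebraic variety in the sense of Serre, i.e. a reduced separated scheme of finite type over $k$, not necessarily irreducible. A variety is called toral if it is isomorphic over $k$ to a closed subvariety of $\mathbf{A}^n \setminus \bigcup_{i=1}^n H_i$ for some integer $n \geq 0$, where $H_i$ is the zero set of the $i$th coordinate function on $\mathbf{A}^n$. A group $G$ is called Jordan if there is a positive integer $d$, depending only on $G$, such that every finite subgroup $K$ of $G$ contains a normal abelian subgroup of index at most $d$ in $K$. Theorem. For every variety $X$ over $k$ and every point $x \in X$ there is an open neighborhood $U$ of $x$ in $X$ such that the group $\mathrm{Aut}(U)$ of automorphisms of $U$ over $k$ is Jordan; moreover, $U$ can be chosen to be toral. -/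

import Mathlib

open CategoryTheory AlgebraicGeometry

universe u

/-- A group `G` is Jordan if there is a positive integer `d` such that every finite subgroup `K`
of `G` contains a normal abelian subgroup whose index in `K` is at most `d`. -/
def IsJordanGroup (G : Type*) [Group G] : Prop :=
  ∃ d : ℕ, 0 < d ∧ ∀ K : Subgroup G, Finite K →
    ∃ A : Subgroup K, A.Normal ∧ IsMulCommutative A ∧ A.index ≤ d

/-- An algebraic variety over an algebraically closed field `k`, as a `k`-scheme: reduced,
separated and of finite type over `k`, not necessarily irreducible. -/
structure IsAlgebraicVariety {k : Type u} [Field k] {X : Scheme.{u}}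
    (f : X ⟶ Spec (CommRingCat.of k)) : Prop where
  reduced : IsReduced X
  separated : IsSeparated f
  locallyOfFiniteType : LocallyOfFiniteType f
  quasiCompact : QuasiCompact f

/-- The automorphism group over `k` of a `k`-scheme `f : X ⟶ Spec k`. -/
abbrev AutOver {k : Type u} [Field k] {X : Scheme.{u}}
    (f : X ⟶ Spec (CommRingCat.of k)) : Type u :=
  Aut (Over.mk f)

/-- The affine `n`-space over `k` with coordinates `x₁, …, xₙ`. -/
noncomputable abbrev affineSpaceOver (k : Type u) [Field k] (n : ℕ) : Scheme.{u} :=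
  AffineSpace (ULift.{u} (Fin n)) (Spec (CommRingCat.of k))

/-- The complement in the affine `n`-space of the union of the `n` coordinate hyperplanes. -/
noncomputable def coordinateComplement (k : Type u) [Field k] (n : ℕ) :
    (affineSpaceOver k n).Opens :=
  ⨅ i : ULift.{u} (Fin n),
    (affineSpaceOver k n).basicOpen (AffineSpace.coord (Spec (CommRingCat.of k)) i)

/-- A variety over `k` is toral if it is isomorphic over `k` to a closed subvariety of the
complement of the coordinate hyperplanes in some affine `n`-space. -/
def IsToral {k : Type u} [Field k] {X : Scheme.{u}}
    (f : X ⟶ Spec (CommRingCat.of k)) : Prop :=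
  ∃ (n : ℕ) (j : X ⟶ (coordinateComplement k n).toScheme), IsClosedImmersion j ∧
    j ≫ (coordinateComplement k n).ι ≫ (affineSpaceOver k n ↘ Spec (CommRingCat.of k)) = f

/-!
Shrink to an affine open neighbourhood `U = Spec A` of `x` such that every irreducible component
of `U` passes through `x` and `A` is generated by units. Then `U` is toral and `Aut U` acts
faithfully on `Aˣ`. By Rosenlicht, the units of `A` modulo those that are algebraic over `k` form a
finitely generated torsion-free group: by Noether normalization, `A` is (for each component) finite
over a polynomial ring, and a unit that is also a unit at all the places above the hyperplane at
infinity is algebraic over `k`. By Minkowski, the finite subgroups of the automorphism group of such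
a lattice have bounded order. The elements of `A` that are algebraic over `k` embed into the local
ring at `x`, so they form a finite extension of `k`, with a finite group of automorphisms. The
automorphisms of `A` acting trivially both on this field and on the lattice commute.
-/

section BoundedGroups

/-- A group is bounded (in the sense of Popov) if the orders of its finite subgroups are bounded. -/
def IsBoundedGroup (G : Type*) [Group G] : Prop :=
  ∃ d : ℕ, ∀ K : Subgroup G, Finite K → Nat.card K ≤ d

variable {G H : Type*} [Group G] [Group H]

lemma IsBoundedGroup.of_finite [Finite G] : IsBoundedGroup G :=
  ⟨Nat.card G, fun K _ ↦ K.card_le_card_group⟩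

lemma IsBoundedGroup.prod (hG : IsBoundedGroup G) (hH : IsBoundedGroup H) :
    IsBoundedGroup (G × H) := by
  obtain ⟨d, hd⟩ := hG
  obtain ⟨e, he⟩ := hH
  refine ⟨d * e, fun K _ ↦ ?_⟩
  let π₁ := (MonoidHom.fst G H).subgroupMap K
  let π₂ := (MonoidHom.snd G H).subgroupMap K
  have finite₁ := Finite.of_surjective π₁ ((MonoidHom.fst G H).subgroupMap_surjective K)
  have finite₂ := Finite.of_surjective π₂ ((MonoidHom.snd G H).subgroupMap_surjective K)
  have injective : Function.Injective (π₁.prod π₂) := fun x y h ↦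
    Subtype.ext (Prod.ext (congrArg (·.1.1) h) (congrArg (·.2.1) h))
  calc Nat.card K ≤ Nat.card (K.map (MonoidHom.fst G H) × K.map (MonoidHom.snd G H)) :=
        Nat.card_le_card_of_injective _ injective
    _ = Nat.card (K.map (MonoidHom.fst G H)) * Nat.card (K.map (MonoidHom.snd G H)) :=
        Nat.card_prod _ _
    _ ≤ d * e := Nat.mul_le_mul (hd _ finite₁) (he _ finite₂)

lemma IsBoundedGroup.of_injective (hH : IsBoundedGroup H) (φ : G →* H)
    (hφ : Function.Injective φ) : IsBoundedGroup G := by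
  obtain ⟨d, hd⟩ := hH
  refine ⟨d, fun K _ ↦ ?_⟩
  let e := K.equivMapOfInjective φ hφ
  exact (Nat.card_congr e.toEquiv).trans_le (hd _ (Finite.of_equiv K e.toEquiv))

lemma IsBoundedGroup.isJordanGroup_of_commutative_ker (hH : IsBoundedGroup H) (φ : G →* H)
    (hφ : ∀ g ∈ φ.ker, ∀ h ∈ φ.ker, g * h = h * g) : IsJordanGroup G := by
  obtain ⟨d, hd⟩ := hH
  refine ⟨d + 1, d.succ_pos, fun K _ ↦ ⟨(φ.comp K.subtype).ker, inferInstance, ⟨⟨?_⟩⟩, ?_⟩⟩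
  · rintro ⟨g, hg⟩ ⟨h, hh⟩
    exact Subtype.ext (Subtype.ext (hφ _ hg _ hh))
  · rw [Subgroup.index_ker]
    exact (hd _ (Set.finite_range (φ.comp K.subtype)).to_subtype).trans d.le_succ

lemma IsJordanGroup.of_injective (hH : IsJordanGroup H) (φ : G →* H)
    (hφ : Function.Injective φ) : IsJordanGroup G := by
  obtain ⟨d, hd, h⟩ := hH
  refine ⟨d, hd, fun K _ ↦ ?_⟩
  let e := K.equivMapOfInjective φ hφ
  obtain ⟨A, hA, hcomm, hindex⟩ := h (K.map φ) (Finite.of_equiv K e.toEquiv)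
  refine ⟨A.comap e.toMonoidHom, inferInstance, ⟨⟨fun a b ↦ Subtype.ext (e.injective ?_)⟩⟩, ?_⟩
  · change e (a * b) = e (b * a)
    rw [map_mul, map_mul]
    exact congrArg Subtype.val (hcomm.1.1 ⟨e a, a.2⟩ ⟨e b, b.2⟩)
  · rwa [Subgroup.index_comap_of_surjective _ e.surjective]

end BoundedGroups

section Minkowski

variable {R : Type*} [Ring R] [Module.Finite ℤ R] [Module.IsTorsionFree ℤ R]

lemma eq_zero_of_eq_smul_mul {n : ℤ} (hn : ¬IsUnit n) {x y : R} (h : x = n • (x * y)) : x = 0 := by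
  have hle : (LinearMap.mulLeft ℤ x).range ≤
      Ideal.span {n} • (LinearMap.mulLeft ℤ x).range := by
    rintro _ ⟨z, rfl⟩
    rw [Submodule.ideal_span_singleton_smul, Submodule.mem_smul_pointwise_iff_exists]
    refine ⟨x * (y * z), ⟨y * z, rfl⟩, ?_⟩
    calc n • (x * (y * z)) = n • (x * y) * z := by rw [smul_mul_assoc, mul_assoc]
      _ = x * z := by rw [← h]
  obtain ⟨r, hr, hrx⟩ := Submodule.exists_sub_one_mem_and_smul_eq_zero_of_fg_of_le_smul _ _
    (IsNoetherian.noetherian _) hle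
  refine (smul_eq_zero.1 (hrx x ⟨1, mul_one x⟩)).resolve_left ?_
  rintro rfl
  rw [Ideal.mem_span_singleton, zero_sub, dvd_neg] at hr
  exact hn (isUnit_of_dvd_one hr)

lemma eq_one_of_pow_three_eq_one {u : R} (hu : u ^ 3 = 1) (h3 : 3 ∣ u - 1) : u = 1 := by
  obtain ⟨t, ht⟩ := h3
  obtain rfl : u = 1 + 3 * t := by rw [← ht]; abel
  have h9 : (9 : ℤ) • (t + 3 * t ^ 2 + 3 * t ^ 3) = 0 := by
    rw [← sub_eq_zero.2 hu]
    noncomm_ring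
  have h := (smul_eq_zero.1 h9).resolve_left (by norm_num)
  have ht3 : t = (3 : ℤ) • (t * (-(t + t ^ 2))) := by
    rw [← sub_eq_zero, ← h]
    noncomm_ring
  rw [eq_zero_of_eq_smul_mul (by decide) ht3, mul_zero, add_zero]

lemma eq_one_of_pow_eq_one_of_coprime {m n : ℕ} (hm : m ≠ 1) {u : R}
    (hu : u ^ n = 1) (hn : n.Coprime m) (h : (m : R) ∣ u - 1) : u = 1 := by
  have hsum : (m : R) ∣ ∑ j ∈ Finset.range n, u ^ j - n := by
    have hsub : ∑ j ∈ Finset.range n, u ^ j - n = ∑ j ∈ Finset.range n, (u ^ j - 1) := by simp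
    rw [hsub]
    exact Finset.dvd_sum fun j _ ↦ h.trans ⟨_, (mul_geom_sum u j).symm⟩
  obtain ⟨w, hw⟩ := hsum
  have hnu : (n : ℤ) • (u - 1) = (m : ℤ) • -((u - 1) * w) := by
    have hgeom := mul_geom_sum u n
    rw [hu, sub_self, sub_eq_iff_eq_add.1 hw, mul_add, ← Nat.cast_comm n,
      (Nat.cast_commute m (u - 1)).symm.left_comm] at hgeom
    rw [natCast_zsmul, natCast_zsmul, nsmul_eq_mul, nsmul_eq_mul, mul_neg]
    exact eq_neg_of_add_eq_zero_right hgeom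
  obtain ⟨a, b, hab⟩ := Nat.isCoprime_iff_coprime.2 hn
  refine sub_eq_zero.1 (eq_zero_of_eq_smul_mul (n := m) (y := b - a • w) ?_ ?_)
  · rwa [Int.ofNat_isUnit, Nat.isUnit_iff]
  · rw [mul_sub, mul_smul_comm, ← Int.cast_comm, ← zsmul_eq_mul]
    linear_combination (norm := module) a • hnu - hab • (u - 1)

theorem eq_one_of_isOfFinOrder_of_three_dvd_sub_one {u : R} (hu : IsOfFinOrder u)
    (h3 : 3 ∣ u - 1) : u = 1 := by
  obtain ⟨n, hn, hun⟩ := isOfFinOrder_iff_pow_eq_one.1 hu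
  induction n using Nat.strong_induction_on generalizing u with
  | _ n ih =>
    by_cases hdvd : 3 ∣ n
    · obtain ⟨m, rfl⟩ := hdvd
      refine eq_one_of_pow_three_eq_one (ih m (by lia) hu.pow ?_ (by lia) ?_) h3
      · exact h3.trans ⟨_, (mul_geom_sum u 3).symm⟩
      · rw [← pow_mul, hun]
    · exact eq_one_of_pow_eq_one_of_coprime (m := 3) (by decide) hun
        (Nat.prime_three.coprime_iff_not_dvd.2 hdvd).symm (by exact_mod_cast h3)

variable (R) in
theorem isBoundedGroup_units : IsBoundedGroup Rˣ := by
  let I : Submodule ℤ R := Ideal.span {(3 : ℤ)} • ⊤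
  have three_dvd_of_mem {x : R} (hx : x ∈ I) : 3 ∣ x := by
    rw [show I = _ from Submodule.ideal_span_singleton_smul _ _,
      Submodule.mem_smul_pointwise_iff_exists] at hx
    obtain ⟨y, -, rfl⟩ := hx
    exact ⟨y, by rw [zsmul_eq_mul]; simp⟩
  have : Finite (ℤ ⧸ Ideal.span {(3 : ℤ)}) :=
    Finite.of_equiv _ (Int.quotientSpanNatEquivZMod 3).symm.toEquiv
  have : Finite (R ⧸ I) := Submodule.finite_quotient_smul _ Module.Finite.fg_top
  refine ⟨Nat.card (R ⧸ I), fun K _ ↦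
    Nat.card_le_card_of_injective (fun u : K ↦ I.mkQ ((u : Rˣ) : R)) fun u v huv ↦ ?_⟩
  have hdvd : 3 ∣ ((u⁻¹ * v : K) : Rˣ).1 - 1 := by
    obtain ⟨w, hw⟩ := three_dvd_of_mem ((Submodule.Quotient.eq I).1 huv.symm)
    refine ⟨((u : Rˣ)⁻¹ : Rˣ) * w, ?_⟩
    have h : ((u⁻¹ * v : K) : Rˣ).1 - 1 = ((u : Rˣ)⁻¹ : Rˣ) * ((v : Rˣ).1 - (u : Rˣ)) := by
      simp [mul_sub]
    rw [h, hw]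
    noncomm_ring
  have hone := eq_one_of_isOfFinOrder_of_three_dvd_sub_one
    (MonoidHom.isOfFinOrder ((Units.coeHom R).comp K.subtype) (isOfFinOrder_of_finite (u⁻¹ * v)))
    hdvd
  exact (inv_mul_eq_one.1 (Subtype.ext (Units.ext hone)))

end Minkowski

theorem isBoundedGroup_mulAut (M : Type*) [CommGroup M] [Group.FG M] [IsMulTorsionFree M] :
    IsBoundedGroup (MulAut M) := by
  let φ : MulAut M →* Module.End ℤ (Additive M) :=
    { toFun e := (MulEquiv.toAdditive e).toAddMonoidHom.toIntLinearMap
      map_one' := rfl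
      map_mul' _ _ := rfl }
  refine (isBoundedGroup_units _).of_injective φ.toHomUnits fun e f h ↦ MulEquiv.ext fun x ↦ ?_
  exact congrArg (fun e : (Module.End ℤ (Additive M))ˣ ↦ (e.1 (.ofMul x)).toMul) h

section FaithfulAction

variable {G E : Type*} [Group G] [CommGroup E] [MulDistribMulAction G E]

/-- The automorphisms of `E ⧸ F` induced by an action on `E` that preserves the subgroup `F`. -/
def quotientMulAut (F : Subgroup E) (hF : ∀ (g : G), ∀ x ∈ F, g • x ∈ F) :
    G →* MulAut (E ⧸ F) where
  toFun g := QuotientGroup.congr F F (MulDistribMulAction.toMulEquiv E g) <|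
    le_antisymm (Subgroup.map_le_iff_le_comap.2 (hF g))
      fun x hx ↦ ⟨g⁻¹ • x, hF g⁻¹ x hx, smul_inv_smul g x⟩
  map_one' := by
    ext x
    induction x using QuotientGroup.induction_on
    simp
  map_mul' g h := by
    ext x
    induction x using QuotientGroup.induction_on
    simp [mul_smul]

lemma smul_div_mem_of_mem_ker_quotientMulAut {F : Subgroup E}
    {hF : ∀ (g : G), ∀ x ∈ F, g • x ∈ F} {g : G} (hg : g ∈ (quotientMulAut F hF).ker) (x : E) :
    g • x / x ∈ F := by
  have h : ((g • x : E) : E ⧸ F) = x := DFunLike.congr_fun (MonoidHom.mem_ker.1 hg) (x : E ⧸ F)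
  rwa [← QuotientGroup.eq_iff_div_mem]

theorem isJordanGroup_of_faithfulSMul [FaithfulSMul G E] {H : Type*} [Group H] {F : Subgroup E}
    [Group.FG (E ⧸ F)] [IsMulTorsionFree (E ⧸ F)] (hF : ∀ (g : G), ∀ x ∈ F, g • x ∈ F)
    (hH : IsBoundedGroup H) (θ : G →* H) (hθ : ∀ g ∈ θ.ker, ∀ x ∈ F, g • x = x) :
    IsJordanGroup G := by
  refine (hH.prod (isBoundedGroup_mulAut (E ⧸ F))).isJordanGroup_of_commutative_ker
    (θ.prod (quotientMulAut F hF)) fun g hg h hh ↦ eq_of_smul_eq_smul fun x : E ↦ ?_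
  rw [MonoidHom.ker_prod] at hg hh
  have mul_smul_eq {g h : G} (hg : g ∈ θ.ker) (hh : h ∈ (quotientMulAut F hF).ker) :
      (g * h) • x = (h • x / x) * (g • x) := by
    rw [mul_smul, ← hθ g hg _ (smul_div_mem_of_mem_ker_quotientMulAut hh x), ← smul_mul',
      div_mul_cancel]
  rw [mul_smul_eq hg.1 hh.2, mul_smul_eq hh.1 hg.2, div_mul_eq_mul_div, div_mul_eq_mul_div,
    mul_comm]

end FaithfulAction

section FinitelyGenerated

variable {E P : Type*} [CommGroup E] [CommGroup P] [Group.FG P]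

lemma fg_subgroup_of_fg (S : Subgroup P) : Group.FG S := by
  rw [Group.fg_iff_subgroup_fg, Subgroup.fg_iff_add_fg,
    ← AddSubgroup.toIntSubmodule_toAddSubgroup S.toAddSubgroup, ← Submodule.fg_iff_addSubgroup_fg]
  exact IsNoetherian.noetherian _

lemma fg_quotient_of_ker_le (ψ : E →* P) {F : Subgroup E} (hF : ψ.ker ≤ F) :
    Group.FG (E ⧸ F) := by
  have := fg_subgroup_of_fg ψ.range
  have : Group.FG (E ⧸ ψ.ker) :=
    Group.fg_of_surjective (f := (QuotientGroup.quotientKerEquivRange ψ).symm.toMonoidHom)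
      (QuotientGroup.quotientKerEquivRange ψ).symm.surjective
  exact Group.fg_of_surjective (f := QuotientGroup.lift ψ.ker (QuotientGroup.mk' F)
      (hF.trans_eq (QuotientGroup.ker_mk' F).symm))
    (QuotientGroup.lift_surjective_of_surjective _ _ (QuotientGroup.mk'_surjective F) _)

end FinitelyGenerated

section IntegralUnits

variable (R A : Type*) [CommRing R] [CommRing A] [Algebra R A]

/-- The units of `A` that are integral over `R` together with their inverses. -/
def integralUnits : Subgroup Aˣ :=
  (integralClosure R A).toSubmonoid.units

variable {R A}

lemma mem_integralUnits {u : Aˣ} :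
    u ∈ integralUnits R A ↔ IsIntegral R (u : A) ∧ IsIntegral R ((u⁻¹ : Aˣ) : A) :=
  Submonoid.mem_units_iff _ _

lemma le_integralUnits {S : Subgroup Aˣ} (hS : ∀ u ∈ S, IsIntegral R (u : A)) :
    S ≤ integralUnits R A :=
  fun u hu ↦ mem_integralUnits.2 ⟨hS u hu, hS u⁻¹ (inv_mem hu)⟩

instance isMulTorsionFree_quotient_integralUnits :
    IsMulTorsionFree (Aˣ ⧸ integralUnits R A) := by
  refine isMulTorsionFree_iff_not_isOfFinOrder (G := Aˣ ⧸ integralUnits R A).2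
    fun x hx hfin ↦ hx ?_
  obtain ⟨u, rfl⟩ := QuotientGroup.mk_surjective x
  obtain ⟨n, hn, hun⟩ := isOfFinOrder_iff_pow_eq_one.1 hfin
  rw [← QuotientGroup.mk_pow, QuotientGroup.eq_one_iff, mem_integralUnits, ← inv_pow,
    Units.val_pow_eq_pow_val, Units.val_pow_eq_pow_val] at hun
  exact (QuotientGroup.eq_one_iff u).2
    (mem_integralUnits.2 ⟨hun.1.of_pow hn, hun.2.of_pow hn⟩)

end IntegralUnits

section DiscreteValuationRing

open IsDedekindDomain

lemma fg_units_quotient_of_finite_heightOneSpectrum (D F : Type*) [CommRing D] [IsDedekindDomain D]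
    [Finite (HeightOneSpectrum D)] [Field F] [Algebra D F] [IsFractionRing D F] :
    Group.FG (Fˣ ⧸ integralUnits D F) := by
  refine fg_quotient_of_ker_le (MonoidHom.pi fun v : HeightOneSpectrum D ↦ v.valuationOfNeZero)
    (le_integralUnits fun u hu ↦ ?_)
  obtain ⟨d, hd⟩ := HeightOneSpectrum.mem_integers_of_valuation_le_one (R := D) F (u : F) fun v ↦ by
    rw [← v.valuationOfNeZero_eq, show v.valuationOfNeZero u = 1 from congrFun hu v]
    rfl
  rw [← hd]
  exact isIntegral_algebraMap

variable (O K F : Type*) [CommRing O] [IsDomain O] [IsDiscreteValuationRing O] [Field K]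
  [Algebra O K] [IsFractionRing O K] [Field F] [Algebra K F] [Algebra O F] [IsScalarTower O K F]

lemma fg_units_quotient_of_isSeparable [FiniteDimensional K F] [Algebra.IsSeparable K F] :
    Group.FG (Fˣ ⧸ integralUnits O F) := by
  let D := integralClosure O F
  have : IsFractionRing D F := IsIntegralClosure.isFractionRing_of_finite_extension O K F D
  have : IsDedekindDomain D := IsIntegralClosure.isDedekindDomain O K F D
  have : FaithfulSMul O F := .trans O K F
  have : Finite (HeightOneSpectrum D) := by
    have := (IsDedekindDomain.primesOver_finite (IsLocalRing.maximalIdeal O) (B := D)).to_subtype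
    refine Finite.of_injective (fun v : HeightOneSpectrum D ↦
      (⟨v.asIdeal, v.isPrime, ⟨?_⟩⟩ : Ideal.primesOver (IsLocalRing.maximalIdeal O) D)) ?_
    · exact (IsLocalRing.eq_maximalIdeal (Ideal.IsMaximal.under O v.asIdeal)).symm
    · exact fun v w h ↦ HeightOneSpectrum.ext (congrArg Subtype.val h)
  have := fg_units_quotient_of_finite_heightOneSpectrum D F
  refine fg_quotient_of_ker_le (P := Fˣ ⧸ integralUnits D F) (QuotientGroup.mk' _)
    (le_integralUnits fun u hu ↦ ?_)
  rw [QuotientGroup.ker_mk', mem_integralUnits] at hu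
  exact isIntegral_trans _ hu.1

theorem fg_units_quotient_of_finiteDimensional [FiniteDimensional K F] :
    Group.FG (Fˣ ⧸ integralUnits O F) := by
  let S := separableClosure K F
  let p := ringExpChar K
  have : IsScalarTower O S F := .to₁₃₄ O K S F
  have := fg_units_quotient_of_isSeparable O K S
  let φ := IsPurelyInseparable.iterateFrobenius S F p
    (le_refl (IsPurelyInseparable.exponent S F))
  refine fg_quotient_of_ker_le (P := Sˣ ⧸ integralUnits O S)
    ((QuotientGroup.mk' (integralUnits O S)).comp (Units.map φ)) (le_integralUnits fun u hu ↦ ?_)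
  rw [MonoidHom.mem_ker, MonoidHom.comp_apply, QuotientGroup.mk'_apply, QuotientGroup.eq_one_iff,
    mem_integralUnits] at hu
  refine IsIntegral.of_pow (n := p ^ IsPurelyInseparable.exponent S F) (expChar_pow_pos K p _) ?_
  rw [← IsPurelyInseparable.algebraMap_iterateFrobenius S p le_rfl]
  exact hu.1.algebraMap

end DiscreteValuationRing

section DegreeValuation

open WithZero

variable (σ R : Type*) [CommRing R] [IsDomain R]

open Classical in
/-- The valuation on a polynomial ring given by the total degree. -/
noncomputable def totalDegreeValuation :
    Valuation (MvPolynomial σ R) (WithZero (Multiplicative ℤ)) where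
  toFun p := if p = 0 then 0 else exp (p.totalDegree : ℤ)
  map_zero' := if_pos rfl
  map_one' := by simp
  map_mul' p q := by
    by_cases hp : p = 0
    · simp [hp]
    by_cases hq : q = 0
    · simp [hq]
    rw [if_neg hp, if_neg hq, if_neg (mul_ne_zero hp hq),
      MvPolynomial.totalDegree_mul_of_isDomain hp hq, ← exp_add, Nat.cast_add]
  map_add_le_max' p q := by
    by_cases hp : p = 0
    · simp [hp]
    by_cases hq : q = 0
    · simp [hq]
    by_cases hpq : p + q = 0
    · simp [hpq]
    rw [if_neg hp, if_neg hq, if_neg hpq, le_max_iff, exp_le_exp, exp_le_exp, Nat.cast_le,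
      Nat.cast_le, ← le_max_iff]
    exact MvPolynomial.totalDegree_add _ _

variable {σ R}

lemma totalDegreeValuation_apply {p : MvPolynomial σ R} (hp : p ≠ 0) :
    totalDegreeValuation σ R p = exp (p.totalDegree : ℤ) :=
  if_neg hp

lemma totalDegreeValuation_ne_zero {p : MvPolynomial σ R} (hp : p ≠ 0) :
    totalDegreeValuation σ R p ≠ 0 := by
  rw [totalDegreeValuation_apply hp]
  exact exp_ne_zero

lemma mem_range_algebraMap_of_totalDegreeValuation_le_one {p : MvPolynomial σ R}
    (hp : totalDegreeValuation σ R p ≤ 1) : p ∈ (algebraMap R (MvPolynomial σ R)).range := by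
  rcases eq_or_ne p 0 with rfl | h0
  · exact zero_mem _
  rw [totalDegreeValuation_apply h0, ← exp_zero, exp_le_exp] at hp
  exact ⟨_, (MvPolynomial.totalDegree_eq_zero_iff_eq_C.1 (by lia)).symm⟩

/-- The discrete valuation ring is the local ring of projective space at the hyperplane at
infinity. -/
lemma exists_isDiscreteValuationRing_forall_mem_range [Nonempty σ] (K : Type*) [Field K]
    [Algebra (MvPolynomial σ R) K] [IsFractionRing (MvPolynomial σ R) K] :
    ∃ O : ValuationSubring K, IsDiscreteValuationRing O ∧
      ∀ p : MvPolynomial σ R, algebraMap _ K p ∈ O → p ∈ (algebraMap R _).range := by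
  have hS : nonZeroDivisors (MvPolynomial σ R) ≤ (totalDegreeValuation σ R).supp.primeCompl :=
    fun p hp ↦ totalDegreeValuation_ne_zero (nonZeroDivisors.ne_zero hp)
  let v := (totalDegreeValuation σ R).extendToLocalization hS K
  have hv (p) : v (algebraMap _ K p) = totalDegreeValuation σ R p :=
    Valuation.extendToLocalization_apply_map_apply _ _ _ _
  have : v.IsNontrivial := by
    obtain ⟨i⟩ := ‹Nonempty σ›
    refine ⟨⟨algebraMap (MvPolynomial σ R) K (MvPolynomial.X i), ?_, ?_⟩⟩ <;> rw [hv]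
    · exact totalDegreeValuation_ne_zero (MvPolynomial.X_ne_zero i)
    · rw [totalDegreeValuation_apply (MvPolynomial.X_ne_zero i), MvPolynomial.totalDegree_X,
        ← exp_zero]
      exact exp_injective.ne (by norm_num)
  refine ⟨v.valuationSubring, inferInstance, fun p hp ↦ ?_⟩
  rw [Valuation.mem_valuationSubring_iff, hv] at hp
  exact mem_range_algebraMap_of_totalDegreeValuation_le_one hp

end DegreeValuation

/-- The minimal polynomial of `x` over `K` has coefficients in both `R` and `O`. -/
lemma isIntegral_of_isIntegral_of_isIntegral {k R O K F : Type*} [CommRing k] [CommRing R]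
    [IsDomain R] [IsIntegrallyClosed R] [CommRing O] [IsDomain O] [IsIntegrallyClosed O] [Field K]
    [Field F] [Algebra R K] [IsFractionRing R K] [Algebra O K] [IsFractionRing O K] [Algebra K F]
    [Algebra R F] [IsScalarTower R K F] [Algebra O F] [IsScalarTower O K F] [Algebra k R]
    [Algebra k F] [IsScalarTower k R F]
    (hRO : ∀ r : R, algebraMap R K r ∈ (algebraMap O K).range → r ∈ (algebraMap k R).range) {x : F}
    (hR : IsIntegral R x) (hO : IsIntegral O x) : IsIntegral k x := by
  have minpoly_R := minpoly.isIntegrallyClosed_eq_field_fractions' K hR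
  have minpoly_O := minpoly.isIntegrallyClosed_eq_field_fractions' K hO
  have coeff_mem (i : ℕ) : (minpoly R x).coeff i ∈ (algebraMap k R).range := by
    refine hRO _ ⟨(minpoly O x).coeff i, ?_⟩
    rw [← Polynomial.coeff_map, ← minpoly_O, minpoly_R, Polynomial.coeff_map]
  obtain ⟨q, hq, -, monic_q⟩ := Polynomial.lifts_and_natDegree_eq_and_monic
    ((Polynomial.lifts_iff_coeff_lifts _).2 coeff_mem) (minpoly.monic hR)
  refine ⟨q, monic_q, ?_⟩
  rw [IsScalarTower.algebraMap_eq k R F, ← Polynomial.eval₂_map, hq]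
  exact minpoly.aeval _ _

lemma isIntegral_of_forall_minimalPrimes {R A : Type*} [CommRing R] [CommRing A] [Algebra R A]
    [IsReduced A] (hA : (minimalPrimes A).Finite) {a : A}
    (ha : ∀ q ∈ minimalPrimes A, IsIntegral R (Ideal.Quotient.mk q a)) : IsIntegral R a := by
  choose! p monic_p hp using ha
  refine ⟨∏ q ∈ hA.toFinset, p q,
    Polynomial.monic_prod_of_monic _ _ fun q hq ↦ monic_p q (hA.mem_toFinset.1 hq), ?_⟩
  rw [← Ideal.mem_bot, ← Ideal.zero_eq_bot, ← nilradical_eq_zero A, nilradical,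
    ← Ideal.sInf_minimalPrimes, Ideal.mem_sInf]
  intro q hq
  rw [← Ideal.Quotient.eq_zero_iff_mem, Polynomial.hom_eval₂]
  exact Polynomial.eval₂_eq_zero_of_dvd_of_eval₂_eq_zero _ _
    (Finset.dvd_prod_of_mem p (hA.mem_toFinset.2 hq)) (hp q hq)

section Rosenlicht

variable (k A : Type*) [Field k] [CommRing A] [Algebra k A]

lemma fg_units_quotient_of_isIntegral [Algebra.IsIntegral k A] :
    Group.FG (Aˣ ⧸ integralUnits k A) :=
  fg_quotient_of_ker_le (P := Unit) 1 (le_integralUnits fun _ _ ↦ Algebra.IsIntegral.isIntegral _)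

lemma fg_units_quotient_of_isDomain [IsDomain A] [Algebra.FiniteType k A] :
    Group.FG (Aˣ ⧸ integralUnits k A) := by
  obtain ⟨s, g, hg, hgfin⟩ := exists_finite_inj_algHom_of_fg k A
  let R := MvPolynomial (Fin s) k
  algebraize [(g : R →+* A)]
  have : IsScalarTower k R A := .of_algebraMap_eq' g.comp_algebraMap.symm
  have : Module.Finite R A := hgfin
  rcases isEmpty_or_nonempty (Fin s) with _ | _
  · have : Module.Finite k R := .equiv (MvPolynomial.isEmptyAlgEquiv k (Fin s)).symm.toLinearEquiv
    have : Module.Finite k A := .trans R A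
    exact fg_units_quotient_of_isIntegral k A
  let K := FractionRing R
  let F := FractionRing A
  have : FaithfulSMul R A := (faithfulSMul_iff_algebraMap_injective R A).2 hg
  let : Algebra K F := FractionRing.liftAlgebra R F
  obtain ⟨O, hO, hOk⟩ := exists_isDiscreteValuationRing_forall_mem_range (σ := Fin s) (R := k) K
  have := fg_units_quotient_of_finiteDimensional O K F
  refine fg_quotient_of_ker_le (P := Fˣ ⧸ integralUnits O F)
    ((QuotientGroup.mk' _).comp (Units.map (algebraMap A F))) (le_integralUnits fun u hu ↦ ?_)
  rw [MonoidHom.mem_ker, MonoidHom.comp_apply, QuotientGroup.mk'_apply, QuotientGroup.eq_one_iff,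
    mem_integralUnits] at hu
  have hR : IsIntegral R (algebraMap A F u) := (Algebra.IsIntegral.isIntegral (u : A)).algebraMap
  refine (isIntegral_algebraMap_iff (IsFractionRing.injective A F)).1
    (isIntegral_of_isIntegral_of_isIntegral (K := K) (fun p hp ↦ hOk p ?_) hR hu.1)
  obtain ⟨a, ha⟩ := hp
  exact ha ▸ a.2

lemma fg_units_quotient [IsReduced A] [Algebra.FiniteType k A] :
    Group.FG (Aˣ ⧸ integralUnits k A) := by
  have := Algebra.FiniteType.isNoetherianRing k A
  have hA := minimalPrimes.finite_of_isNoetherianRing A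
  have := hA.to_subtype
  have (q : minimalPrimes A) : Group.FG ((A ⧸ q.1)ˣ ⧸ integralUnits k (A ⧸ q.1)) :=
    have : q.1.IsPrime := q.2.1.1
    fg_units_quotient_of_isDomain k (A ⧸ q.1)
  refine fg_quotient_of_ker_le (P := ∀ q : minimalPrimes A, (A ⧸ q.1)ˣ ⧸ integralUnits k (A ⧸ q.1))
    (MonoidHom.pi fun q ↦ (QuotientGroup.mk' _).comp (Units.map (Ideal.Quotient.mk q.1)))
    (le_integralUnits fun u hu ↦ isIntegral_of_forall_minimalPrimes hA fun q hq ↦ ?_)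
  exact (mem_integralUnits.1 ((QuotientGroup.eq_one_iff _).1 (congrFun hu ⟨q, hq⟩))).1

end Rosenlicht

section AlgebraAutomorphisms

section

variable (R : Type*) {A : Type*} [CommRing R] [CommRing A] [Algebra R A]

/-- The action of the automorphisms of an algebra on the integral closure of the base ring. -/
def mapIntegralClosureHom : (A ≃ₐ[R] A) →* (integralClosure R A ≃ₐ[R] integralClosure R A) where
  toFun e := e.mapIntegralClosure
  map_one' := rfl
  map_mul' _ _ := rfl

lemma algEquiv_faithfulSMul_units (h : Algebra.adjoin R (Set.range ((↑) : Aˣ → A)) = ⊤) :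
    FaithfulSMul (A ≃ₐ[R] A) Aˣ where
  eq_of_smul_eq_smul {g g'} hgg' := by
    refine AlgEquiv.coe_toAlgHom_injective (AlgHom.ext_of_adjoin_eq_top h ?_)
    rintro _ ⟨u, rfl⟩
    exact congrArg Units.val (hgg' u)

end

lemma isUnit_of_isUnit_map_of_isIntegral {k B L : Type*} [Field k] [CommRing B] [Algebra k B]
    [CommRing L] {γ : B →+* L} (hγ : Function.Injective γ) {b : B}
    (hb : IsIntegral k b) (hu : IsUnit (γ b)) : IsUnit b :=
  (IsArtinianRing.isUnit_iff_nonZeroDivisor_of_isIntegral hb).2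
    (comap_nonZeroDivisors_le_of_injective hγ hu.mem_nonZeroDivisors)

variable (k : Type*) {A L : Type*} [Field k] [CommRing A] [Algebra k A] [CommRing L]

lemma isField_integralClosure_of_injective [IsReduced A] [IsLocalRing L] {γ : A →+* L}
    (hγ : Function.Injective γ) : IsField (integralClosure k A) := by
  let γB := γ.comp (algebraMap (integralClosure k A) A)
  have hγB : Function.Injective γB := hγ.comp Subtype.val_injective
  have : IsLocalHom γB := ⟨fun b ↦ isUnit_of_isUnit_map_of_isIntegral hγB
    (Algebra.IsIntegral.isIntegral (R := k) b)⟩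
  have : IsLocalRing (integralClosure k A) := RingHom.domain_isLocalRing γB
  have : Ring.KrullDimLE 0 (integralClosure k A) := .mk₀ fun I _ ↦
    Ideal.isMaximal_of_isIntegral_of_isMaximal_comap (R := k) I
      ((I.comap (algebraMap k _)).isMaximal_of_isPrime)
  have : IsReduced (integralClosure k A) :=
    isReduced_of_injective (integralClosure k A).val Subtype.val_injective
  exact Ring.KrullDimLE.isField_of_isReduced

lemma finiteDimensional_integralClosure_of_isField [Algebra.FiniteType k A]
    (h : IsField (integralClosure k A)) : FiniteDimensional k (integralClosure k A) := by
  have := h.nontrivial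
  have : Nontrivial A := (Subtype.val_injective (p := (· ∈ integralClosure k A))).nontrivial
  obtain ⟨m, hm⟩ := Ideal.exists_maximal A
  let := Ideal.Quotient.field m
  have : Module.Finite k (A ⧸ m) := finite_of_finite_type_of_isJacobsonRing k (A ⧸ m)
  let := h.toField
  let φ : integralClosure k A →ₐ[k] A ⧸ m :=
    (Ideal.Quotient.mkₐ k m).comp (integralClosure k A).val
  exact .of_injective φ.toLinearMap φ.toRingHom.injective

theorem isJordanGroup_algEquiv [IsReduced A] [Algebra.FiniteType k A]
    (hA : Algebra.adjoin k (Set.range ((↑) : Aˣ → A)) = ⊤)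
    (hB : IsField (integralClosure k A)) : IsJordanGroup (A ≃ₐ[k] A) := by
  have := algEquiv_faithfulSMul_units k hA
  have := fg_units_quotient k A
  have := finiteDimensional_integralClosure_of_isField k hB
  let := hB.toField
  refine isJordanGroup_of_faithfulSMul (F := integralUnits k A) (fun g u hu ↦ ?_)
    IsBoundedGroup.of_finite
    (mapIntegralClosureHom k) fun g hg u hu ↦ ?_
  · rw [mem_integralUnits] at hu ⊢
    exact ⟨hu.1.map g.toAlgHom, hu.2.map g.toAlgHom⟩
  · exact Units.ext <| congrArg Subtype.val <| DFunLike.congr_fun (MonoidHom.mem_ker.1 hg)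
      (⟨u, (mem_integralUnits.1 hu).1⟩ : integralClosure k A)

end AlgebraAutomorphisms

section UnitGenerators

variable {R A : Type*} [CommRing R] [CommRing A] [Algebra R A]

/-- If `γ a` is not a unit, then `γ (a + 1)` is one. -/
lemma exists_finset_adjoin_eq_top_forall_isUnit_map [Algebra.FiniteType R A] {L : Type*}
    [CommRing L] [IsLocalRing L] (γ : A →+* L) :
    ∃ t : Finset A, Algebra.adjoin R (t : Set A) = ⊤ ∧ ∀ a ∈ t, IsUnit (γ a) := by
  classical
  obtain ⟨s, hs⟩ := Algebra.FiniteType.out (R := R) (A := A)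
  let φ (a : A) : A := if IsUnit (γ a) then a else a + 1
  have mem_adjoin {a : A} (ha : a ∈ s) : a ∈ Algebra.adjoin R (s.image φ : Set A) := by
    have hφa : φ a ∈ Algebra.adjoin R (s.image φ : Set A) :=
      Algebra.subset_adjoin (Finset.mem_image_of_mem φ ha)
    dsimp only [φ] at hφa
    split_ifs at hφa
    · exact hφa
    · exact (add_mem_cancel_right (one_mem _)).1 hφa
  have isUnit_map (a : A) : IsUnit (γ (φ a)) := by
    dsimp only [φ]
    split_ifs with ha
    · exact ha
    · rw [map_add, map_one]
      exact (IsLocalRing.isUnit_or_isUnit_of_add_one (add_neg_cancel_comm (γ a) 1)).resolve_right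
        (mt (IsUnit.neg_iff _).1 ha)
  exact ⟨s.image φ, top_le_iff.1 (hs ▸ Algebra.adjoin_le fun a ↦ mem_adjoin),
    Finset.forall_mem_image.2 fun a _ ↦ isUnit_map a⟩

lemma adjoin_insert_invSelf_eq_top {B : Type*} [CommRing B] [Algebra R B] [Algebra A B]
    [IsScalarTower R A B] {t : Set A} (ht : Algebra.adjoin R t = ⊤) (h : A)
    [IsLocalization.Away h B] :
    Algebra.adjoin R (insert (IsLocalization.Away.invSelf h) (algebraMap A B '' t)) = ⊤ := by
  set S := Algebra.adjoin R (insert (IsLocalization.Away.invSelf h) (algebraMap A B '' t))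
  have algebraMap_mem (a : A) : algebraMap A B a ∈ S := by
    have : Algebra.adjoin R t ≤ S.comap (IsScalarTower.toAlgHom R A B) :=
      Algebra.adjoin_le fun a ha ↦
        Algebra.subset_adjoin (Set.mem_insert_of_mem _ (Set.mem_image_of_mem _ ha))
    exact this (ht ▸ Algebra.mem_top)
  refine eq_top_iff.2 fun b _ ↦ ?_
  obtain ⟨n, a, hb⟩ := IsLocalization.Away.surj h b
  have hb : b = algebraMap A B a * IsLocalization.Away.invSelf h ^ n := by
    rw [← hb, mul_assoc, ← mul_pow, IsLocalization.Away.mul_invSelf, one_pow, mul_one]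
  rw [hb]
  exact mul_mem (algebraMap_mem a) (pow_mem (Algebra.subset_adjoin (Set.mem_insert _ _)) n)

lemma exists_units_adjoin_eq_top_of_away_prod {t : Finset A}
    (ht : Algebra.adjoin R (t : Set A) = ⊤) (B : Type*) [CommRing B] [Algebra R B] [Algebra A B]
    [IsScalarTower R A B] [IsLocalization.Away (∏ a ∈ t, a) B] :
    ∃ (n : ℕ) (v : Fin n → Bˣ), Algebra.adjoin R (Set.range fun i ↦ (v i : B)) = ⊤ := by
  have htop := adjoin_insert_invSelf_eq_top (B := B) ht (∏ a ∈ t, a)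
  have isUnit_of_mem : ∀ b ∈ insert (IsLocalization.Away.invSelf (∏ a ∈ t, a))
      (algebraMap A B '' t), IsUnit b := by
    rintro _ (rfl | ⟨a, ha, rfl⟩)
    · exact .of_mul_eq_one_right _ (IsLocalization.Away.mul_invSelf _)
    · exact isUnit_of_dvd_unit (map_dvd _ (Finset.dvd_prod_of_mem (fun a ↦ a) ha))
        (IsLocalization.Away.algebraMap_isUnit _)
  obtain ⟨n, w, -, hw⟩ := ((t.finite_toSet.image (algebraMap A B)).insert
    (IsLocalization.Away.invSelf (∏ a ∈ t, a))).fin_param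
  choose v hv using fun i ↦ isUnit_of_mem (w i) (hw ▸ Set.mem_range_self i)
  exact ⟨n, v, by rw [funext hv, hw, htop]⟩

end UnitGenerators

section AlgSpec

open Opposite

/-- The automorphisms of an algebra induced by those of the corresponding object of the opposite
category; composing with the inverse makes the correspondence covariant. -/
def autOpHom {R : Type u} [CommRing R] (A : CommAlgCat.{u} R) : Aut (op A) →* (A ≃ₐ[R] A) where
  toFun a := CommAlgCat.algEquivOfIso (Iso.unop a.symm)
  map_one' := rfl
  map_mul' _ _ := rfl

lemma autOpHom_injective {R : Type u} [CommRing R] (A : CommAlgCat.{u} R) :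
    Function.Injective (autOpHom A) := fun _ _ hab ↦
  congrArg (fun i : A ≅ A ↦ i.op.symm) (CommAlgCat.isoEquivAlgEquiv.injective hab)

variable {k B : Type u} [Field k] [CommRing B] [Algebra k B] {X : Scheme.{u}}
  {f : X ⟶ Spec (CommRingCat.of k)}

lemma isJordanGroup_autOver_of_iso_algSpec
    (e : Over.mk f ≅ (algSpec (.of k)).obj (op (.of k B))) (h : IsJordanGroup (B ≃ₐ[k] B)) :
    IsJordanGroup (AutOver f) := by
  let B' := op (CommAlgCat.of (CommRingCat.of k) B)
  have h_op : IsJordanGroup (Aut B') := h.of_injective _ (autOpHom_injective _)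
  let e_spec := algSpec.fullyFaithful.autMulEquivOfFullyFaithful B'
  let e_aut := e.conjAut.trans e_spec.symm
  exact h_op.of_injective e_aut.toMonoidHom e_aut.injective

lemma isToral_of_isClosedImmersion {n : ℕ} (j : X ⟶ affineSpaceOver k n) [IsClosedImmersion j]
    (hj : ∀ i, IsUnit (j.appTop (AffineSpace.coord _ i))) :
    IsToral (j ≫ (affineSpaceOver k n ↘ Spec (CommRingCat.of k))) := by
  have hrange : Set.range j ⊆ Set.range (coordinateComplement k n).ι := by
    rintro _ ⟨x, rfl⟩
    rw [Scheme.Opens.range_ι, coordinateComplement, TopologicalSpace.Opens.coe_iInf, Set.mem_iInter]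
    intro i
    change x ∈ j ⁻¹ᵁ (affineSpaceOver k n).basicOpen (AffineSpace.coord _ i)
    rw [Scheme.preimage_basicOpen_top, Scheme.basicOpen_of_isUnit _ (hj i)]
    trivial
  refine ⟨n, IsOpenImmersion.lift (coordinateComplement k n).ι j hrange, ?_, ?_⟩
  · have : IsClosedImmersion (IsOpenImmersion.lift (coordinateComplement k n).ι j hrange ≫
        (coordinateComplement k n).ι) := by rwa [IsOpenImmersion.lift_fac]
    exact IsClosedImmersion.of_comp _ (coordinateComplement k n).ι
  · rw [IsOpenImmersion.lift_fac_assoc]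

open MvPolynomial in
lemma isToral_SpecMap_algebraMap {n : ℕ} (v : Fin n → Bˣ)
    (hv : Algebra.adjoin k (Set.range fun i ↦ (v i : B)) = ⊤) :
    IsToral (Spec.map (CommRingCat.ofHom (algebraMap k B))) := by
  let φ : MvPolynomial (ULift.{u} (Fin n)) k →ₐ[k] B := aeval fun i ↦ (v i.down : B)
  have hφ : Function.Surjective φ := by
    rw [← AlgHom.range_eq_top, ← Algebra.adjoin_range_eq_range_aeval, ← hv]
    exact congrArg _ (Equiv.ulift.surjective.range_comp fun i ↦ (v i : B))
  have := IsClosedImmersion.spec_of_surjective (CommRingCat.ofHom φ.toRingHom) hφ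
  let j : Spec (.of B) ⟶ affineSpaceOver k n :=
    Spec.map (CommRingCat.ofHom φ.toRingHom) ≫ (AffineSpace.SpecIso _ (.of k)).inv
  have j_over : j ≫ (affineSpaceOver k n ↘ Spec (CommRingCat.of k)) =
      Spec.map (CommRingCat.ofHom (algebraMap k B)) := by
    rw [Category.assoc, AffineSpace.SpecIso_inv_over, ← Spec.map_comp, ← CommRingCat.ofHom_comp]
    exact congrArg (fun g ↦ Spec.map (CommRingCat.ofHom g)) φ.comp_algebraMap
  have j_coord (i) : j.appTop (AffineSpace.coord _ i) =
      (Scheme.ΓSpecIso (.of B)).inv (v i.down : B) := by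
    rw [Scheme.Hom.comp_appTop, CommRingCat.comp_apply, AffineSpace.SpecIso_inv_appTop_coord,
      ← CommRingCat.comp_apply, ← Scheme.ΓSpecIso_inv_naturality, CommRingCat.comp_apply]
    exact congrArg _ (aeval_X _ i)
  rw [← j_over]
  exact isToral_of_isClosedImmersion j fun i ↦ j_coord i ▸ (v i.down).isUnit.map _

lemma IsToral.of_iso {Y : Scheme.{u}} {g : Y ⟶ Spec (CommRingCat.of k)}
    (hg : IsToral g) (e : Over.mk f ≅ Over.mk g) : IsToral f := by
  obtain ⟨n, j, hj, rfl⟩ := hg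
  let i : X ⟶ Y := e.hom.left
  have : IsIso i := inferInstanceAs (IsIso ((Over.forget _).map e.hom))
  exact ⟨n, i ≫ j, inferInstance, by simpa using Over.w e.hom⟩

end AlgSpec

section Sections

open Opposite

variable {R : Type u} [CommRing R] {X : Scheme.{u}} (f : X ⟶ Spec (CommRingCat.of R))

/-- The structure map of the algebra of sections of a `R`-scheme over an open subset. -/
noncomputable def sectionsHom (U : X.Opens) : CommRingCat.of R ⟶ Γ(X, U) :=
  (Scheme.ΓSpecIso (CommRingCat.of R)).inv ≫ f.appLE ⊤ U (show U ≤ f ⁻¹ᵁ ⊤ from le_top)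

lemma sectionsHom_map {U V : X.Opens} (i : U ≤ V) :
    sectionsHom f V ≫ X.presheaf.map (homOfLE i).op = sectionsHom f U := by
  rw [sectionsHom, Category.assoc, Scheme.Hom.appLE_map, sectionsHom]

lemma isoSpec_hom_SpecMap_sectionsHom {U : X.Opens} (hU : IsAffineOpen U) :
    hU.isoSpec.hom ≫ Spec.map (sectionsHom f U) = U.ι ≫ f := by
  rw [sectionsHom, Spec.map_comp, ← Scheme.isoSpec_Spec_inv, ← IsAffineOpen.fromSpec_top,
    IsAffineOpen.SpecMap_appLE_fromSpec f _ hU, IsAffineOpen.isoSpec_hom_fromSpec_assoc]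

lemma finiteType_sectionsHom [LocallyOfFiniteType f] {U : X.Opens} (hU : IsAffineOpen U) :
    (sectionsHom f U).hom.FiniteType :=
  (f.finiteType_appLE (isAffineOpen_top _) hU le_top).comp <| .of_surjective _
    (Scheme.ΓSpecIso (CommRingCat.of R)).symm.commRingCatIsoToRingEquiv.surjective

/-- An affine open subscheme of a `R`-scheme is the spectrum of its algebra of sections. -/
noncomputable def overIsoAlgSpec {U : X.Opens} (hU : IsAffineOpen U) :
    letI := (sectionsHom f U).hom.toAlgebra
    Over.mk (U.ι ≫ f) ≅ (algSpec (.of R)).obj (op (.of R Γ(X, U))) :=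
  letI := (sectionsHom f U).hom.toAlgebra
  Over.isoMk hU.isoSpec (isoSpec_hom_SpecMap_sectionsHom f hU)

lemma exists_isAffineOpen_adjoin_units_eq_top [IsNoetherianRing R]
    [LocallyOfFiniteType f] (x : X) :
    ∃ (U : X.Opens) (hx : x ∈ U), IsAffineOpen U ∧
      Function.Injective (X.presheaf.germ U x hx) ∧
      letI := (sectionsHom f U).hom.toAlgebra
      ∃ (n : ℕ) (v : Fin n → Γ(X, U)ˣ),
        Algebra.adjoin R (Set.range fun i ↦ (v i : Γ(X, U))) = ⊤ := by
  have : IsLocallyNoetherian X := LocallyOfFiniteType.isLocallyNoetherian f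
  obtain ⟨V, hxV, hV, hinj⟩ := X.exists_germ_injective x
  let := (sectionsHom f V).hom.toAlgebra
  have : Algebra.FiniteType R Γ(X, V) := finiteType_sectionsHom f hV
  obtain ⟨t, ht, htu⟩ :=
    exists_finset_adjoin_eq_top_forall_isUnit_map (R := R) (X.presheaf.germ V x hxV).hom
  let h : Γ(X, V) := ∏ a ∈ t, a
  have hxU : x ∈ X.basicOpen h := by
    refine (X.mem_basicOpen h x hxV).2 ?_
    change IsUnit ((X.presheaf.germ V x hxV).hom h)
    rw [map_prod]
    exact IsUnit.prod_iff.2 htu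
  let := (sectionsHom f (X.basicOpen h)).hom.toAlgebra
  have : IsScalarTower R Γ(X, V) Γ(X, X.basicOpen h) := .of_algebraMap_eq' <|
    congrArg CommRingCat.Hom.hom (sectionsHom_map f (X.basicOpen_le h)).symm
  have : IsLocalization.Away h Γ(X, X.basicOpen h) := hV.isLocalization_basicOpen h
  exact ⟨X.basicOpen h, hxU, hV.basicOpen h, injective_germ_basicOpen V hV x hxV h hxU hinj,
    exists_units_adjoin_eq_top_of_away_prod ht Γ(X, X.basicOpen h)⟩

end Sections

theorem mainTheorem8_general (k : Type u) [Field k] (X : Scheme.{u}) [IsReduced X]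
    (f : X ⟶ Spec (CommRingCat.of k)) [LocallyOfFiniteType f] (x : X) :
    ∃ U : X.Opens, x ∈ U ∧ IsToral (U.ι ≫ f) ∧ IsJordanGroup (AutOver (U.ι ≫ f)) := by
  obtain ⟨U, hx, hU, hinj, n, v, hv⟩ := exists_isAffineOpen_adjoin_units_eq_top f x
  let := (sectionsHom f U).hom.toAlgebra
  have : Algebra.FiniteType k Γ(X, U) := finiteType_sectionsHom f hU
  have adjoin_units : Algebra.adjoin k (Set.range ((↑) : Γ(X, U)ˣ → Γ(X, U))) = ⊤ :=
    top_le_iff.1 <| hv ▸ Algebra.adjoin_mono (Set.range_comp_subset_range v _)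
  have isField : IsField (integralClosure k Γ(X, U)) :=
    isField_integralClosure_of_injective k (γ := (X.presheaf.germ U x hx).hom) hinj
  let e := overIsoAlgSpec f hU
  exact ⟨U, hx, (isToral_SpecMap_algebraMap v hv).of_iso e,
    isJordanGroup_autOver_of_iso_algSpec e (isJordanGroup_algEquiv k adjoin_units isField)⟩

theorem mainTheorem8 (k : Type u) [Field k] [IsAlgClosed k] [CharZero k]
    (X : Scheme.{u}) (f : X ⟶ Spec (CommRingCat.of k)) (hX : IsAlgebraicVariety f) (x : X) :
    ∃ U : X.Opens, x ∈ U ∧ IsToral (U.ι ≫ f) ∧ IsJordanGroup (AutOver (U.ι ≫ f)) :=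
  have := hX.reduced
  have := hX.locallyOfFiniteType
  mainTheorem8_general k X f x
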